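/- Let $H$ be a separable real Hilbert space, let $\mu_\xi=\mathcal N(0,\Gamma)$ be a centred Gaussian measure on $H$ with positive-definite covariance operator $\Gamma$, and let $(\lambda_k^2,\varphi_k)_k$, $\lambda_k>0$, be an orthonormal eigensystem of $\Gamma$. For $t\ge 0$ put $$\|x\|_t=\|\Gamma^{-t/2}x\|=\Big(\sum_k\lambda_k^{-2t}\langle x,\varphi_k\rangle^2\Big)^{1/2}\in[0,\infty],\qquad \mathcal H^t=\{x\in H:\|x\|_t<\infty\},\qquad B^t_R(u)=\{x:\|u-x\|_t\le R\},$$ $$\langle u,v\rangle_1=\sum_k\lambda_k^{-2}\langle u,\varphi_k\rangle\langle v,\varphi_k\rangle\quad\text{whenever the series converges absolutely;}$$ $\|\cdot\|_1$ is the Cameron–Martin norm of $\mu_\xi$. Let $\sigma_0\ge 0$ be such that $\Gamma^\sigma$ is trace class for every $\sigma>\sigma_0$, i.e. $\sum_k\lambda_k^{2\sigma}<\infty$. Let $\mu_0$ be a Borel probability measure on $H$ (the prior) such that, for some $s>1+\sigma_0$ and some $U<\infty$, $\|a\|_s\le U$ for $\mu_0$-a.e. $a$. Consider the regression model $y=a+n^{-1/2}\xi$,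 $\xi\sim\mu_\xi$, with posterior $\mu_n^{y}$ given by $$\frac{d\mu_n^{y}}{d\mu_0}(a)\;\propto\;\exp\Big(-\frac n2\|a\|_1^2+n\langle a,y\rangle_1\Big).$$ Fix a truth $a^\dagger\in\mathcal H^s$ with $\mu_0(B^1_\epsilon(a^\dagger))>0$ for all $\epsilon>0$ (i.e. $a^\dagger\in\operatorname{supp}_{\mathcal H^1}\mu_0$), and let $y_n=a^\dagger+n^{-1/2}\xi$ with $\xi\sim\mu_\xi$. 1. For every $n\ge 1$ and $\mu_\xi$-a.e. $\xi$, the posterior $\mu_n^{y_n}$ is well defined: the series $\langle a,y_n\rangle_1$ converges absolutely for $\mu_0$-a.e. $a$, and the density above can be normalized to give a probability measure. 2. The posterior is consistent in $\mathcal H^1$: for every $\epsilon>0$ there is a sequence $l_n\to1$ such that $\mu_\xi\big(\mu_n^{y_n}(B^1_\epsilon(a^\dagger))\ge l_n\big)\to1$ as $n\to\infty$. 3. If moreover, for some $\rho>0$, $\log\mu_0(B^1_\epsilon(a^\dagger))\gtrsim-\epsilon^{-\rho}$ as $\epsilon\downarrow0$ (that is, there are $C,\epsilon_0>0$ with $\log\mu_0(B^1_\epsilon(a^\dagger))\ge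 -C\epsilon^{-\rho}$ for $0<\epsilon<\epsilon_0$), then for every $$\kappa<\min\Big\{\frac1{2(2-\lambda)},\frac1{2+\rho}\Big\},\qquad \lambda=\frac{s-1-\sigma_0}{s-1},$$ the posterior is consistent in $\mathcal H^1$ with rate $n^{-\kappa}$: there are a constant $M>0$ and a sequence $l_n\to1$ such that $\mu_\xi\big(\mu_n^{y_n}(B^1_{Mn^{-\kappa}}(a^\dagger))\ge l_n\big)\to1$ as $n\to\infty$. -/

import Mathlib

open Real Set Filter Topology MeasureTheory ProbabilityTheory
open scoped ENNReal NNReal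

noncomputable section

/-- `μ` is the centred Gaussian measure `N(0, Γ)` on the Hilbert space `H`. -/
structure IsCentredGaussian {H : Type*} [NormedAddCommGroup H] [InnerProductSpace ℝ H]
    [CompleteSpace H] [MeasurableSpace H] [BorelSpace H]
    (μ : Measure H) (Γ : H →L[ℝ] H) : Prop where
  isGaussian : IsGaussian μ
  mean_eq_zero : ∫ x, x ∂μ = 0
  covariance_eq : covarianceOperator μ = Γ

/-- `(lam k ^ 2, φ k)` is an eigensystem of the positive-definite operator `Γ`: the orthonormal
basis `φ` diagonalizes `Γ` and the eigenvalue of `φ k` is `lam k ^ 2 > 0`. -/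
def IsEigensystem {H ι : Type*} [NormedAddCommGroup H] [InnerProductSpace ℝ H]
    (Γ : H →L[ℝ] H) (lam : ι → ℝ) (φ : HilbertBasis ι ℝ H) : Prop :=
  ∀ k, 0 < lam k ∧ Γ (φ k) = (lam k ^ 2) • φ k

section HilbertScale

variable {H ι : Type*} [NormedAddCommGroup H] [InnerProductSpace ℝ H]
  (lam : ι → ℝ) (φ : HilbertBasis ι ℝ H)

/-- The Hilbert scale norm `‖x‖_t = ‖Γ^(-t/2) x‖` of an element of `H`, for the operator `Γ` with
eigensystem `(lam k ^ 2, φ k)`, with the value `∞` if `x` is not in the domain of `Γ^(-t/2)`.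
For `t = 1` it is the Cameron–Martin norm of `N(0, Γ)`. -/
def scaleNorm (t : ℝ) (x : H) : ℝ≥0∞ :=
  (∑' k, ENNReal.ofReal (lam k ^ (-2 * t) * inner ℝ (φ k) x ^ 2)) ^ (1 / 2 : ℝ)

/-- The space `ℋ^t` of the Hilbert scale, for `t ≥ 0` (when it is a subspace of `H`). -/
def scaleSpace (t : ℝ) : Set H := {x | scaleNorm lam φ t x < ∞}

/-- The ball `B_R^t(u) = {x | ‖u - x‖_t ≤ R}`. -/
def scaleBall (t : ℝ) (u : H) (R : ℝ) : Set H :=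
  {x | scaleNorm lam φ t (u - x) ≤ ENNReal.ofReal R}

/-- The terms of the series `⟨u, v⟩_t = ⟨Γ^(-t/2) u, Γ^(-t/2) v⟩` in the eigenbasis. -/
def scaleInnerTerm (t : ℝ) (u v : H) (k : ι) : ℝ :=
  lam k ^ (-2 * t) * (inner ℝ (φ k) u * inner ℝ (φ k) v)

/-- `⟨u, v⟩_t`, given by its series in the eigenbasis whenever that converges absolutely
(`v` need not belong to `ℋ^t` if `u` is more regular). -/
def scaleInner (t : ℝ) (u v : H) : ℝ := ∑' k, scaleInnerTerm lam φ t u v k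

/-- The support of `μ` with respect to the norm `‖·‖_t`. -/
def scaleSupport [MeasurableSpace H] (t : ℝ) (μ : Measure H) : Set H :=
  {x | ∀ ε : ℝ, 0 < ε → 0 < μ (scaleBall lam φ t x ε)}

/-- The unnormalized posterior density
`a ↦ exp (-(n/2) ‖a‖_1² + n ⟨a, y⟩_1)` with respect to the prior, in the regression model
`y = a + n^(-1/2) ξ` with noise `ξ ∼ N(0, Γ)`. -/
def posteriorDensity (n : ℕ) (y a : H) : ℝ≥0∞ :=
  ENNReal.ofReal (Real.exp
    (-(n / 2 : ℝ) * (scaleNorm lam φ 1 a).toReal ^ 2 + n * scaleInner lam φ 1 a y))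

/-- The posterior `μ^y` for the prior `μ₀` in the regression model `y = a + n^(-1/2) ξ`. -/
def regressionPosterior [MeasurableSpace H] (μ₀ : Measure H) (n : ℕ) (y : H) : Measure H :=
  (∫⁻ a, posteriorDensity lam φ n y a ∂μ₀)⁻¹ • μ₀.withDensity (posteriorDensity lam φ n y)

end HilbertScale

/-- The data `y_n = a† + n^(-1/2) ξ`. -/
def smallNoiseData {H : Type*} [NormedAddCommGroup H] [InnerProductSpace ℝ H]
    (a : H) (n : ℕ) (ξ : H) : H := a + (√(n : ℝ))⁻¹ • ξ

/-- The random measures `post n ξ`, where `ξ ∼ P`, concentrate on the sets `B n`: there are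
`l n → 1` such that `P (post n ξ (B n) ≥ l n) → 1`. -/
def PosteriorConcentrates {Ω X : Type*} [MeasurableSpace Ω] [MeasurableSpace X]
    (P : Measure Ω) (post : ℕ → Ω → Measure X) (B : ℕ → Set X) : Prop :=
  ∃ l : ℕ → ℝ, Tendsto l atTop (𝓝 1) ∧
    Tendsto (fun n => P {ξ | ENNReal.ofReal (l n) ≤ post n ξ (B n)}) atTop (𝓝 1)

/-- Posterior consistency, where `B r` is the ball of radius `r` around the truth: the posterior
concentrates on every ball of fixed positive radius. -/
def PosteriorConsistent {Ω X : Type*} [MeasurableSpace Ω] [MeasurableSpace X]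
    (P : Measure Ω) (post : ℕ → Ω → Measure X) (B : ℝ → Set X) : Prop :=
  ∀ ε : ℝ, 0 < ε → PosteriorConcentrates P post (fun _ => B ε)

/-- Posterior consistency with rate `ε n`, where `B r` is the ball of radius `r` around the
truth. -/
def PosteriorConsistentWithRate {Ω X : Type*} [MeasurableSpace Ω] [MeasurableSpace X]
    (P : Measure Ω) (post : ℕ → Ω → Measure X) (B : ℝ → Set X) (ε : ℕ → ℝ) : Prop :=
  ∃ M : ℝ, 0 < M ∧ PosteriorConcentrates P post (fun n => B (M * ε n))

end

/-! Write `x = ‖a† - a‖_1`. Completing the square turns the log-density at `a` into `c - (n/2) x² +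
w`, where `c` is independent of `a` and `w = -√n ⟨a† - a, ξ⟩_1`. The noise need not lie in `ℋ^1`,
but `E ‖ξ‖_{1-σ}² = ∑ λ_k^{2σ}` is finite for `σ > σ₀`. Duality between `ℋ^{1+σ}` and `ℋ^{1-σ}`,
then interpolation of `1 + σ` between `1` and `s`, give `|w| ≤ √n ‖ξ‖_{1-σ} K^θ x^{1-θ}`, where `θ =
σ/(s-1)` and `K` bounds `‖a† - a‖_s` on the prior (`exists_posteriorDensity_eq`).

Since `1 - θ < 2`, the quadratic term wins once `x` exceeds a threshold `δ`. Comparing the density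
outside the `r`-ball with that on the `δ`-ball bounds the posterior mass outside by `exp(-(3/8) n r²
+ (5/8) n δ²) / μ₀(B_δ)` (`regressionPosterior_scaleBall_ge`). This holds whenever `‖ξ‖_{1-σ} ≤ z`;
letting `z = z_n → ∞` slowly makes that event have probability tending to one. Consistency takes `δ`
fixed; the rate takes `δ = n^{-κ}`, which the noise permits if `2κ(1+θ) < 1` and the small ball
bound if `κρ ≤ 1 - 2κ`. -/

theorem ENNReal.tsum_rpow_mul_rpow_le {ι : Type*} (f g : ι → ℝ≥0∞) {p q : ℝ}
    (hp : 0 ≤ p) (hq : 0 ≤ q) (hpq : p + q = 1) :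
    ∑' k, f k ^ p * g k ^ q ≤ (∑' k, f k) ^ p * (∑' k, g k) ^ q := by
  -- Hölder's inequality for the counting measure; on the discrete σ-algebra every function is
  -- measurable.
  let _ : MeasurableSpace ι := ⊤
  have h := ENNReal.lintegral_mul_norm_pow_le (μ := (Measure.count : Measure ι))
    (f := f) (g := g) measurable_from_top.aemeasurable measurable_from_top.aemeasurable hp hq hpq
  simpa [lintegral_count] using h

/-! ### The Hilbert scale and the regularity of the noise -/

section Scale

variable {H ι : Type*} [NormedAddCommGroup H] [InnerProductSpace ℝ H]
  {lam : ι → ℝ} {φ : HilbertBasis ι ℝ H}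

theorem scaleNorm_sq (t : ℝ) (x : H) :
    scaleNorm lam φ t x ^ 2 = ∑' k, ENNReal.ofReal (lam k ^ (-2 * t) * inner ℝ (φ k) x ^ 2) := by
  rw [scaleNorm, ← ENNReal.rpow_natCast, ← ENNReal.rpow_mul]
  norm_num

/-- The interpolation inequality of the Hilbert scale. -/
theorem scaleNorm_interpolation (hlam : ∀ k, 0 < lam k) {p q : ℝ} (hp : 0 ≤ p) (hq : 0 ≤ q)
    (hpq : p + q = 1) (t₀ t₁ : ℝ) (x : H) :
    scaleNorm lam φ (p * t₀ + q * t₁) x ≤ scaleNorm lam φ t₀ x ^ p * scaleNorm lam φ t₁ x ^ q := by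
  have h := ENNReal.tsum_rpow_mul_rpow_le
    (fun k => ENNReal.ofReal (lam k ^ (-2 * t₀) * inner ℝ (φ k) x ^ 2))
    (fun k => ENNReal.ofReal (lam k ^ (-2 * t₁) * inner ℝ (φ k) x ^ 2)) hp hq hpq
  have hterm : ∀ k, ENNReal.ofReal (lam k ^ (-2 * t₀) * inner ℝ (φ k) x ^ 2) ^ p *
      ENNReal.ofReal (lam k ^ (-2 * t₁) * inner ℝ (φ k) x ^ 2) ^ q =
      ENNReal.ofReal (lam k ^ (-2 * (p * t₀ + q * t₁)) * inner ℝ (φ k) x ^ 2) := by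
    intro k
    have hk := hlam k
    have hn (t : ℝ) : 0 ≤ lam k ^ t := (rpow_pos_of_pos hk t).le
    rw [ENNReal.ofReal_rpow_of_nonneg (by have := hn (-2 * t₀); positivity) hp,
      ENNReal.ofReal_rpow_of_nonneg (by have := hn (-2 * t₁); positivity) hq,
      ← ENNReal.ofReal_mul (by have := hn (-2 * t₀); positivity),
      mul_rpow (hn _) (sq_nonneg _), mul_rpow (hn _) (sq_nonneg _), ← rpow_mul hk.le,
      ← rpow_mul hk.le]
    congr 1
    calc _ = (lam k ^ (-2 * t₀ * p) * lam k ^ (-2 * t₁ * q)) *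
          ((inner ℝ (φ k) x ^ 2) ^ p * (inner ℝ (φ k) x ^ 2) ^ q) := by ring
      _ = _ := by
        rw [← rpow_add hk, ← rpow_add_of_nonneg (sq_nonneg _) hp hq, hpq, rpow_one]
        ring_nf
  simp only [hterm] at h
  unfold scaleNorm
  calc _ ≤ ((∑' k, ENNReal.ofReal (lam k ^ (-2 * t₀) * inner ℝ (φ k) x ^ 2)) ^ p *
        (∑' k, ENNReal.ofReal (lam k ^ (-2 * t₁) * inner ℝ (φ k) x ^ 2)) ^ q) ^ (1 / 2 : ℝ) :=
      ENNReal.rpow_le_rpow h (by norm_num)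
    _ = _ := by
      rw [ENNReal.mul_rpow_of_nonneg _ _ (by norm_num)]
      simp only [← ENNReal.rpow_mul, mul_comm]

theorem scaleNorm_zero_ne_top (x : H) : scaleNorm lam φ 0 x ≠ ∞ := by
  have h : Summable fun k => inner ℝ (φ k) x ^ 2 := by
    simpa using φ.orthonormal.inner_products_summable x
  unfold scaleNorm
  refine ENNReal.rpow_ne_top_of_nonneg (by norm_num) ?_
  simpa using h.tsum_ofReal_ne_top

/-- Interpolation between `0` and `s`; no bound on the `lam k` is needed. -/
theorem scaleNorm_ne_top_of_le (hlam : ∀ k, 0 < lam k) {t s : ℝ} (ht : 0 ≤ t) (hts : t ≤ s)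
    (hs : 0 < s) {x : H} (hx : scaleNorm lam φ s x ≠ ∞) : scaleNorm lam φ t x ≠ ∞ := by
  have h1 : 0 ≤ 1 - t / s := by rw [sub_nonneg, div_le_one hs]; exact hts
  have h := scaleNorm_interpolation (φ := φ) hlam h1 (div_nonneg ht hs.le) (by ring) 0 s x
  rw [mul_zero, zero_add, div_mul_cancel₀ _ hs.ne'] at h
  refine ne_top_of_le_ne_top (ENNReal.mul_ne_top ?_ ?_) h
  · exact ENNReal.rpow_ne_top_of_nonneg h1 (scaleNorm_zero_ne_top x)
  · exact ENNReal.rpow_ne_top_of_nonneg (div_nonneg ht hs.le) hx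

theorem scaleNorm_sub_sq_le (hlam : ∀ k, 0 < lam k) (t : ℝ) (u v : H) :
    scaleNorm lam φ t (u - v) ^ 2 ≤
      2 * (scaleNorm lam φ t u ^ 2 + scaleNorm lam φ t v ^ 2) := by
  simp only [scaleNorm_sq]
  rw [← ENNReal.tsum_add, ← ENNReal.tsum_mul_left]
  refine ENNReal.tsum_le_tsum fun k => ?_
  have hn : 0 ≤ lam k ^ (-2 * t) := (rpow_pos_of_pos (hlam k) _).le
  rw [← ENNReal.ofReal_add (by positivity) (by positivity), ← ENNReal.ofReal_ofNat,
    ← ENNReal.ofReal_mul (by norm_num)]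
  refine ENNReal.ofReal_le_ofReal ?_
  rw [inner_sub_right]
  nlinarith [mul_nonneg hn (sq_nonneg (inner ℝ (φ k) u + inner ℝ (φ k) v))]

/-- Cauchy–Schwarz after splitting the weight as `lam^(-2t) = lam^(-(t+r)) lam^(-(t-r))`. Extra
regularity of `u` compensates for the roughness of `v`, which gives meaning to the pairing with the
noise. -/
theorem tsum_abs_scaleInnerTerm_le (hlam : ∀ k, 0 < lam k) (t r : ℝ) (u v : H) :
    ∑' k, ENNReal.ofReal |scaleInnerTerm lam φ t u v k| ≤
      scaleNorm lam φ (t + r) u * scaleNorm lam φ (t - r) v := by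
  have h := ENNReal.tsum_rpow_mul_rpow_le
    (fun k => ENNReal.ofReal (lam k ^ (-2 * (t + r)) * inner ℝ (φ k) u ^ 2))
    (fun k => ENNReal.ofReal (lam k ^ (-2 * (t - r)) * inner ℝ (φ k) v ^ 2))
    (p := 1 / 2) (q := 1 / 2) (by norm_num) (by norm_num) (by norm_num)
  refine le_trans (le_of_eq (tsum_congr fun k => ?_)) h
  have hk := hlam k
  have hn (t : ℝ) : 0 ≤ lam k ^ t := (rpow_pos_of_pos hk t).le
  have h1 := hn (-2 * (t + r))
  have h2 := hn (-2 * (t - r))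
  rw [ENNReal.ofReal_rpow_of_nonneg (by positivity) (by norm_num),
    ENNReal.ofReal_rpow_of_nonneg (by positivity) (by norm_num),
    ← ENNReal.ofReal_mul (by positivity), ← mul_rpow (by positivity) (by positivity),
    ← sqrt_eq_rpow, ← sqrt_sq_eq_abs]
  congr 2
  have h3 : lam k ^ (-2 * (t + r)) * lam k ^ (-2 * (t - r)) = (lam k ^ (-2 * t)) ^ 2 := by
    rw [← rpow_add hk, sq, ← rpow_add hk]
    ring_nf
  rw [scaleInnerTerm]
  linear_combination -(inner ℝ (φ k) u ^ 2 * inner ℝ (φ k) v ^ 2) * h3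

theorem summable_scaleInnerTerm (hlam : ∀ k, 0 < lam k) {t : ℝ} (r : ℝ) {u v : H}
    (hu : scaleNorm lam φ (t + r) u ≠ ∞) (hv : scaleNorm lam φ (t - r) v ≠ ∞) :
    Summable (scaleInnerTerm lam φ t u v) := by
  have h := ne_top_of_le_ne_top (ENNReal.mul_ne_top hu hv)
    (tsum_abs_scaleInnerTerm_le (φ := φ) hlam t r u v)
  have h' := ENNReal.summable_toReal h
  simp only [ENNReal.toReal_ofReal (abs_nonneg _)] at h'
  exact h'.of_abs

theorem abs_scaleInner_le (hlam : ∀ k, 0 < lam k) {t : ℝ} (r : ℝ) {u v : H}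
    (hu : scaleNorm lam φ (t + r) u ≠ ∞) (hv : scaleNorm lam φ (t - r) v ≠ ∞) :
    |scaleInner lam φ t u v| ≤
      (scaleNorm lam φ (t + r) u).toReal * (scaleNorm lam φ (t - r) v).toReal := by
  have hs := summable_scaleInnerTerm (φ := φ) hlam r hu hv
  have h := ENNReal.toReal_mono (ENNReal.mul_ne_top hu hv)
    (tsum_abs_scaleInnerTerm_le (φ := φ) hlam t r u v)
  rw [ENNReal.toReal_mul] at h
  refine le_trans ?_ h
  rw [← ENNReal.ofReal_tsum_of_nonneg (fun _ => abs_nonneg _) hs.abs,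
    ENNReal.toReal_ofReal (tsum_nonneg fun _ => abs_nonneg _)]
  exact norm_tsum_le_tsum_norm (f := scaleInnerTerm lam φ t u v) hs.abs

theorem toReal_scaleNorm_sq (hlam : ∀ k, 0 < lam k) (t : ℝ) (x : H) :
    (scaleNorm lam φ t x).toReal ^ 2 = scaleInner lam φ t x x := by
  rw [← ENNReal.toReal_pow, scaleNorm_sq, scaleInner, ENNReal.tsum_toReal_eq (by simp)]
  refine tsum_congr fun k => ?_
  have hn : 0 ≤ lam k ^ (-2 * t) := (rpow_pos_of_pos (hlam k) _).le
  rw [ENNReal.toReal_ofReal (by positivity), scaleInnerTerm, sq]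

/-- Completing the square in the log-density of the regression model. -/
theorem log_density_eq (hlam : ∀ k, 0 < lam k) (n : ℕ) {a b ξ : H}
    (ha : scaleNorm lam φ 1 a ≠ ∞) (hb : scaleNorm lam φ 1 b ≠ ∞)
    (haξ : Summable (scaleInnerTerm lam φ 1 a ξ)) (hbξ : Summable (scaleInnerTerm lam φ 1 b ξ)) :
    Summable (scaleInnerTerm lam φ 1 a (smallNoiseData b n ξ)) ∧
    -(n / 2 : ℝ) * (scaleNorm lam φ 1 a).toReal ^ 2
        + n * scaleInner lam φ 1 a (smallNoiseData b n ξ) =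
      (n / 2 : ℝ) * scaleInner lam φ 1 b b + √n * scaleInner lam φ 1 b ξ
        - (n / 2 : ℝ) * (scaleNorm lam φ 1 (b - a)).toReal ^ 2
        - √n * scaleInner lam φ 1 (b - a) ξ := by
  have fin {x : H} (hx : scaleNorm lam φ 1 x ≠ ∞) : scaleNorm lam φ (1 + 0) x ≠ ∞ ∧
      scaleNorm lam φ (1 - 0) x ≠ ∞ := by simpa using hx
  have saa := summable_scaleInnerTerm (φ := φ) hlam 0 (fin ha).1 (fin ha).2
  have sab := summable_scaleInnerTerm (φ := φ) hlam 0 (fin ha).1 (fin hb).2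
  have sbb := summable_scaleInnerTerm (φ := φ) hlam 0 (fin hb).1 (fin hb).2
  have e1 : scaleInnerTerm lam φ 1 a (smallNoiseData b n ξ) = fun k =>
      scaleInnerTerm lam φ 1 a b k + (√n)⁻¹ * scaleInnerTerm lam φ 1 a ξ k := by
    ext k
    simp only [scaleInnerTerm, smallNoiseData, inner_add_right, inner_smul_right]
    ring
  have e2 : scaleInnerTerm lam φ 1 (b - a) (b - a) = fun k =>
      scaleInnerTerm lam φ 1 b b k - 2 * scaleInnerTerm lam φ 1 a b k
        + scaleInnerTerm lam φ 1 a a k := by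
    ext k
    simp only [scaleInnerTerm, inner_sub_right]
    ring
  have e3 : scaleInnerTerm lam φ 1 (b - a) ξ = fun k =>
      scaleInnerTerm lam φ 1 b ξ k - scaleInnerTerm lam φ 1 a ξ k := by
    ext k
    simp only [scaleInnerTerm, inner_sub_right]
    ring
  refine ⟨by rw [e1]; exact sab.add (haξ.mul_left _), ?_⟩
  have f1 : scaleInner lam φ 1 a (smallNoiseData b n ξ) =
      scaleInner lam φ 1 a b + (√n)⁻¹ * scaleInner lam φ 1 a ξ := by
    rw [scaleInner, e1, sab.tsum_add (haξ.mul_left _), tsum_mul_left]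
    rfl
  have f2 : scaleInner lam φ 1 (b - a) (b - a) =
      scaleInner lam φ 1 b b - 2 * scaleInner lam φ 1 a b + scaleInner lam φ 1 a a := by
    rw [scaleInner, e2, (sbb.sub (sab.mul_left _)).tsum_add saa, sbb.tsum_sub (sab.mul_left _),
      tsum_mul_left]
    rfl
  have f3 : scaleInner lam φ 1 (b - a) ξ = scaleInner lam φ 1 b ξ - scaleInner lam φ 1 a ξ := by
    rw [scaleInner, e3, hbξ.tsum_sub haξ]
    rfl
  have hn : (n : ℝ) * (√n)⁻¹ = √n := by
    rw [← div_eq_mul_inv, Real.div_sqrt]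
  rw [toReal_scaleNorm_sq hlam, toReal_scaleNorm_sq hlam, f1, f2, f3]
  linear_combination scaleInner lam φ 1 a ξ * hn

theorem measurable_scaleNorm [Countable ι] [MeasurableSpace H] [BorelSpace H] (t : ℝ) :
    Measurable (scaleNorm lam φ t) := by
  unfold scaleNorm
  refine Measurable.pow_const (Measurable.tsum fun k => ?_) _
  exact ENNReal.measurable_ofReal.comp (by fun_prop : Continuous fun x : H =>
    lam k ^ (-2 * t) * inner ℝ (φ k) x ^ 2).measurable

theorem measurableSet_scaleBall [Countable ι] [MeasurableSpace H] [BorelSpace H]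
    (t : ℝ) (u : H) (R : ℝ) : MeasurableSet (scaleBall lam φ t u R) := by
  unfold scaleBall scaleNorm
  refine measurableSet_le (Measurable.pow_const (Measurable.tsum fun k => ?_) _)
    measurable_const
  exact ENNReal.measurable_ofReal.comp (by fun_prop : Continuous fun x : H =>
    lam k ^ (-2 * t) * inner ℝ (φ k) (u - x) ^ 2).measurable

theorem scaleBall_mono (t : ℝ) (u : H) {R R' : ℝ} (h : R ≤ R') :
    scaleBall lam φ t u R ⊆ scaleBall lam φ t u R' :=
  fun _ hx => le_trans hx (ENNReal.ofReal_le_ofReal h)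

/-- The second moment of the noise in the weaker norms of the Hilbert scale. -/
theorem lintegral_scaleNorm_sq [CompleteSpace H] [TopologicalSpace.SeparableSpace H] [Countable ι]
    [MeasurableSpace H] [BorelSpace H] {Γ : H →L[ℝ] H} (hΓ : IsEigensystem Γ lam φ)
    {μ : Measure H} (hμ : IsCentredGaussian μ Γ) (t : ℝ) :
    ∫⁻ x, scaleNorm lam φ t x ^ 2 ∂μ = ∑' k, ENNReal.ofReal (lam k ^ (2 * (1 - t))) := by
  have := hμ.isGaussian
  have : SecondCountableTopology H := UniformSpace.secondCountable_of_separable H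
  have hmem : MemLp id 2 μ := IsGaussian.memLp_two_id
  simp only [scaleNorm_sq]
  have hmeas (k : ι) : AEMeasurable
      (fun x => ENNReal.ofReal (lam k ^ (-2 * t) * inner ℝ (φ k) x ^ 2)) μ :=
    (ENNReal.measurable_ofReal.comp (by fun_prop : Continuous fun x : H =>
      lam k ^ (-2 * t) * inner ℝ (φ k) x ^ 2).measurable).aemeasurable
  rw [lintegral_tsum hmeas]
  refine tsum_congr fun k => ?_
  obtain ⟨hk, he⟩ := hΓ k
  have hint : Integrable (fun x => inner ℝ (φ k) x ^ 2) μ :=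
    (hmem.const_inner (φ k)).integrable_sq
  have hn : 0 ≤ lam k ^ (-2 * t) := (rpow_pos_of_pos hk _).le
  rw [← ofReal_integral_eq_lintegral_ofReal (hint.const_mul _)
    (ae_of_all _ fun x => by positivity), integral_const_mul]
  congr 1
  have h := covarianceOperator_inner hmem (φ k) (φ k)
  rw [hμ.covariance_eq, he, inner_smul_left, real_inner_self_eq_norm_sq, φ.orthonormal.1 k] at h
  simp only [← sq] at h
  rw [← h]
  simp only [conj_trivial, one_pow, mul_one]
  rw [← rpow_natCast, ← rpow_add hk]
  congr 1
  push_cast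
  ring

end Scale

/-! ### Mass estimates for normalized densities -/

section NormalizedDensity

variable {X : Type*} [MeasurableSpace X] {μ : Measure X} {f : X → ℝ≥0∞}

theorem isProbabilityMeasure_normalized_withDensity (h₀ : ∫⁻ a, f a ∂μ ≠ 0)
    (h₁ : ∫⁻ a, f a ∂μ ≠ ∞) :
    IsProbabilityMeasure ((∫⁻ a, f a ∂μ)⁻¹ • μ.withDensity f) := by
  constructor
  rw [Measure.smul_apply, withDensity_apply _ MeasurableSet.univ, Measure.restrict_univ,
    smul_eq_mul, ENNReal.inv_mul_cancel h₀ h₁]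

theorem ofReal_mul_measure_le_lintegral {v : ℝ} {B : Set X} (hB : MeasurableSet B)
    (hv : ∀ᵐ a ∂μ, a ∈ B → ENNReal.ofReal v ≤ f a) :
    ENNReal.ofReal v * μ B ≤ ∫⁻ a, f a ∂μ := by
  calc ENNReal.ofReal v * μ B = ∫⁻ _ in B, ENNReal.ofReal v ∂μ := by simp
    _ ≤ ∫⁻ a in B, f a ∂μ := setLIntegral_mono_ae' hB hv
    _ ≤ _ := setLIntegral_le_lintegral _ _

/-- The mass of a normalized density on `B'` is close to one if the density is small outside of
`B'` and large on some set `B`. -/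
theorem le_normalized_withDensity_apply [IsProbabilityMeasure μ] {u v : ℝ} (hv₀ : 0 < v)
    (hu₀ : 0 ≤ u) {B B' : Set X} (hB : MeasurableSet B) (hB' : MeasurableSet B') (hμB : 0 < μ B)
    (hint : ∫⁻ a, f a ∂μ ≠ ∞) (hv : ∀ᵐ a ∂μ, a ∈ B → ENNReal.ofReal v ≤ f a)
    (hu : ∀ᵐ a ∂μ, a ∈ B'ᶜ → f a ≤ ENNReal.ofReal u) :
    ENNReal.ofReal (1 - u / (v * μ.real B)) ≤ ((∫⁻ a, f a ∂μ)⁻¹ • μ.withDensity f) B' := by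
  have hlow := ofReal_mul_measure_le_lintegral hB hv
  have hvB : 0 < v * μ.real B := mul_pos hv₀ (ENNReal.toReal_pos hμB.ne' (measure_ne_top _ _))
  have hlow' : ENNReal.ofReal (v * μ.real B) ≤ ∫⁻ a, f a ∂μ := by
    rwa [ENNReal.ofReal_mul hv₀.le, ofReal_measureReal]
  have hpos : ∫⁻ a, f a ∂μ ≠ 0 := ((ENNReal.ofReal_pos.2 hvB).trans_le hlow').ne'
  have := isProbabilityMeasure_normalized_withDensity hpos hint
  set P := (∫⁻ a, f a ∂μ)⁻¹ • μ.withDensity f with hP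
  have hcompl : P B'ᶜ ≤ ENNReal.ofReal (u / (v * μ.real B)) := by
    rw [hP, Measure.smul_apply, withDensity_apply _ hB'.compl, smul_eq_mul,
      ENNReal.ofReal_div_of_pos hvB, div_eq_mul_inv, mul_comm]
    refine mul_le_mul' ?_ (ENNReal.inv_le_inv.2 hlow')
    calc ∫⁻ a in B'ᶜ, f a ∂μ ≤ ∫⁻ _ in B'ᶜ, ENNReal.ofReal u ∂μ :=
          setLIntegral_mono_ae' hB'.compl hu
      _ = ENNReal.ofReal u * μ B'ᶜ := by simp
      _ ≤ _ := mul_le_of_le_one_right' prob_le_one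
  have h1 : P B' = 1 - P B'ᶜ := by
    rw [← prob_compl_eq_one_sub hB'.compl, compl_compl]
  rw [h1, ENNReal.ofReal_sub _ (div_nonneg hu₀ hvB.le), ENNReal.ofReal_one]
  exact tsub_le_tsub_left hcompl _

end NormalizedDensity

/-- Scaling by `x / δ ≥ 1` favours the larger exponent, so the noise need only be compared with the
quadratic term at the threshold. -/
theorem mul_rpow_le_of_le {A N δ x p : ℝ} (hA : A * δ ^ p ≤ N * δ ^ 2) (hδ : 0 < δ) (hx : δ ≤ x)
    (hN : 0 ≤ N) (hp : p ≤ 2) : A * x ^ p ≤ N * x ^ 2 := by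
  have hy : 1 ≤ x / δ := (one_le_div hδ).2 hx
  have hxe : x = δ * (x / δ) := by field_simp
  have hy0 : 0 ≤ x / δ := by linarith
  rw [hxe, mul_rpow hδ.le hy0]
  calc A * (δ ^ p * (x / δ) ^ p) = A * δ ^ p * (x / δ) ^ p := by ring
    _ ≤ N * δ ^ 2 * (x / δ) ^ p := by gcongr
    _ ≤ N * δ ^ 2 * (x / δ) ^ (2 : ℝ) := by
      gcongr
    _ = N * (δ * (x / δ)) ^ 2 := by rw [rpow_two]; ring

/-! ### Posterior mass of balls on a good noise event -/

section Regression

variable {H ι : Type*} [NormedAddCommGroup H] [InnerProductSpace ℝ H]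
  {lam : ι → ℝ} {φ : HilbertBasis ι ℝ H}

/-- The constant `c` may depend on `n` and `ξ`, but being the same for all `a` it cancels in the
posterior. -/
theorem exists_posteriorDensity_eq (hlam : ∀ k, 0 < lam k) {s σ K z : ℝ} (hσ : 0 ≤ σ)
    (hs : 1 < s) (hσs : 1 + σ ≤ s) (hK : 0 ≤ K) (hz : 0 ≤ z) {b ξ : H}
    (hb : scaleNorm lam φ s b ≠ ∞) (hξ : scaleNorm lam φ (1 - σ) ξ ≤ ENNReal.ofReal z) (n : ℕ) :
    ∃ c : ℝ, ∀ a, scaleNorm lam φ s a ≠ ∞ → scaleNorm lam φ s (b - a) ≤ ENNReal.ofReal K →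
      scaleNorm lam φ 1 (b - a) ≠ ∞ ∧
      Summable (scaleInnerTerm lam φ 1 a (smallNoiseData b n ξ)) ∧
      ∃ w : ℝ, |w| ≤ √n * z * K ^ (σ / (s - 1)) *
          (scaleNorm lam φ 1 (b - a)).toReal ^ (1 - σ / (s - 1)) ∧
        posteriorDensity lam φ n (smallNoiseData b n ξ) a =
          ENNReal.ofReal (exp (c - n / 2 * (scaleNorm lam φ 1 (b - a)).toReal ^ 2 + w)) := by
  have fin1 {x : H} (hx : scaleNorm lam φ s x ≠ ∞) : scaleNorm lam φ 1 x ≠ ∞ :=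
    scaleNorm_ne_top_of_le hlam zero_le_one hs.le (by linarith) hx
  have finσ {x : H} (hx : scaleNorm lam φ s x ≠ ∞) : scaleNorm lam φ (1 + σ) x ≠ ∞ :=
    scaleNorm_ne_top_of_le hlam (by linarith) hσs (by linarith) hx
  have hξ' : scaleNorm lam φ (1 - σ) ξ ≠ ∞ := ne_top_of_le_ne_top ENNReal.ofReal_ne_top hξ
  have hs1 : 0 < s - 1 := by linarith
  have hθ0 : 0 ≤ σ / (s - 1) := div_nonneg hσ hs1.le
  have hθ1 : 0 ≤ 1 - σ / (s - 1) := by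
    rw [sub_nonneg, div_le_one hs1]; linarith
  refine ⟨(n / 2 : ℝ) * scaleInner lam φ 1 b b + √n * scaleInner lam φ 1 b ξ, fun a ha haK => ?_⟩
  have hba : scaleNorm lam φ s (b - a) ≠ ∞ := ne_top_of_le_ne_top ENNReal.ofReal_ne_top haK
  obtain ⟨hsum, heq⟩ := log_density_eq (φ := φ) hlam n (fin1 ha) (fin1 hb)
    (summable_scaleInnerTerm hlam σ (finσ ha) hξ') (summable_scaleInnerTerm hlam σ (finσ hb) hξ')
  refine ⟨fin1 hba, hsum, -(√n * scaleInner lam φ 1 (b - a) ξ), ?_, ?_⟩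
  · rw [abs_neg, abs_mul, abs_of_nonneg (sqrt_nonneg _)]
    have h1 := abs_scaleInner_le (φ := φ) hlam σ (finσ hba) hξ'
    have h2 := scaleNorm_interpolation (φ := φ) hlam hθ1 hθ0 (by ring) 1 s (b - a)
    -- The weight `σ / (s - 1)` is the one placing `1 + σ` between `1` and `s`.
    have he : (1 - σ / (s - 1)) * 1 + σ / (s - 1) * s = 1 + σ := by
      field_simp; ring
    rw [he] at h2
    have h3 := ENNReal.toReal_mono (ENNReal.mul_ne_top
      (ENNReal.rpow_ne_top_of_nonneg hθ1 (fin1 hba))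
      (ENNReal.rpow_ne_top_of_nonneg hθ0 hba)) h2
    rw [ENNReal.toReal_mul, ← ENNReal.toReal_rpow, ← ENNReal.toReal_rpow] at h3
    have hz' := ENNReal.toReal_le_of_le_ofReal hz hξ
    have hK' := ENNReal.toReal_le_of_le_ofReal hK haK
    calc √n * |scaleInner lam φ 1 (b - a) ξ|
        ≤ √n * (((scaleNorm lam φ 1 (b - a)).toReal ^ (1 - σ / (s - 1)) *
          K ^ (σ / (s - 1))) * z) := by
          gcongr
          refine h1.trans (mul_le_mul (h3.trans ?_) hz' ENNReal.toReal_nonneg (by positivity))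
          gcongr
      _ = _ := by ring
  · rw [posteriorDensity, heq, ← sub_eq_add_neg]

variable [MeasurableSpace H] [BorelSpace H] [Countable ι]

/-- By `hδA`, the noise term is at most `(n/8) max(x, δ)²`. Hence the exponent is at least `c -
(5/8) n δ²` on the `δ`-ball and at most `c - (3/8) n r²` off the `r`-ball, as `5/8 = 1/2 + 1/8` and
`3/8 = 1/2 - 1/8`. -/
theorem regressionPosterior_scaleBall_ge (hlam : ∀ k, 0 < lam k) {s σ K z : ℝ} (hσ : 0 ≤ σ)
    (hs : 1 < s) (hσs : 1 + σ ≤ s) (hK : 0 ≤ K) (hz : 0 ≤ z) {b ξ : H}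
    (hb : scaleNorm lam φ s b ≠ ∞) (hξ : scaleNorm lam φ (1 - σ) ξ ≤ ENNReal.ofReal z) (n : ℕ)
    {μ₀ : Measure H} [IsProbabilityMeasure μ₀] (hμs : ∀ᵐ a ∂μ₀, scaleNorm lam φ s a ≠ ∞)
    (hμK : ∀ᵐ a ∂μ₀, scaleNorm lam φ s (b - a) ≤ ENNReal.ofReal K)
    (hb_supp : b ∈ scaleSupport lam φ 1 μ₀) {δ : ℝ} (hδ : 0 < δ)
    (hδA : √n * z * K ^ (σ / (s - 1)) * δ ^ (1 - σ / (s - 1)) ≤ n / 8 * δ ^ 2) :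
    IsProbabilityMeasure (regressionPosterior lam φ μ₀ n (smallNoiseData b n ξ)) ∧
    ∀ r, δ ≤ r → ENNReal.ofReal (1 - exp (-(3 / 8) * n * r ^ 2 + 5 / 8 * n * δ ^ 2) /
        μ₀.real (scaleBall lam φ 1 b δ)) ≤
      regressionPosterior lam φ μ₀ n (smallNoiseData b n ξ) (scaleBall lam φ 1 b r) := by
  obtain ⟨c, hc⟩ := exists_posteriorDensity_eq (φ := φ) hlam hσ hs hσs hK hz hb hξ n
  have hs1 : 0 < s - 1 := by linarith
  have hp0 : 0 ≤ 1 - σ / (s - 1) := by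
    rw [sub_nonneg, div_le_one hs1]; linarith
  have hp2 : 1 - σ / (s - 1) ≤ 2 := by have := div_nonneg hσ hs1.le; linarith
  set p := 1 - σ / (s - 1) with hp
  set A := √n * z * K ^ (σ / (s - 1)) with hA
  have hA0 : 0 ≤ A := by positivity
  have hn : (0 : ℝ) ≤ n := Nat.cast_nonneg n
  have hB := measurableSet_scaleBall (lam := lam) (φ := φ) 1 b δ
  have small {x : ℝ} (hx0 : 0 ≤ x) (hx : x ≤ δ) : A * x ^ p ≤ n / 8 * δ ^ 2 :=
    le_trans (by gcongr) hδA
  have large {x : ℝ} (hx : δ ≤ x) : A * x ^ p ≤ n / 8 * x ^ 2 :=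
    mul_rpow_le_of_le hδA hδ hx (by positivity) hp2
  set f := posteriorDensity lam φ n (smallNoiseData b n ξ) with hf
  have hv : ∀ᵐ a ∂μ₀, a ∈ scaleBall lam φ 1 b δ →
      ENNReal.ofReal (exp (c - 5 / 8 * n * δ ^ 2)) ≤ f a := by
    filter_upwards [hμs, hμK] with a h1 h2 haB
    obtain ⟨h3, -, w, hw, hfa⟩ := hc a h1 h2
    rw [hfa]
    have hx0 : 0 ≤ (scaleNorm lam φ 1 (b - a)).toReal := ENNReal.toReal_nonneg
    have hx := ENNReal.toReal_le_of_le_ofReal hδ.le haB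
    have := small hx0 hx
    have h4 : (scaleNorm lam φ 1 (b - a)).toReal ^ 2 ≤ δ ^ 2 := by gcongr
    have h5 := mul_le_mul_of_nonneg_left h4 hn
    refine ENNReal.ofReal_le_ofReal (exp_le_exp.2 ?_)
    linarith [neg_abs_le w]
  have hM : ∀ᵐ a ∂μ₀, f a ≤ ENNReal.ofReal (exp (c + n / 8 * δ ^ 2)) := by
    filter_upwards [hμs, hμK] with a h1 h2
    obtain ⟨h3, -, w, hw, hfa⟩ := hc a h1 h2
    rw [hfa]
    have hx0 : 0 ≤ (scaleNorm lam φ 1 (b - a)).toReal := ENNReal.toReal_nonneg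
    refine ENNReal.ofReal_le_ofReal (exp_le_exp.2 ?_)
    have h6 : 0 ≤ n / 8 * δ ^ 2 := by positivity
    have h7 : 0 ≤ n / 8 * (scaleNorm lam φ 1 (b - a)).toReal ^ 2 := by positivity
    rcases le_total (scaleNorm lam φ 1 (b - a)).toReal δ with hx | hx
    · linarith [small hx0 hx, le_abs_self w]
    · linarith [large hx, le_abs_self w]
  have hint : ∫⁻ a, f a ∂μ₀ ≠ ∞ := by
    refine ne_top_of_le_ne_top ?_ (lintegral_mono_ae hM)
    simp
  have hpos : ∫⁻ a, f a ∂μ₀ ≠ 0 := by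
    refine (lt_of_lt_of_le ?_ (ofReal_mul_measure_le_lintegral hB hv)).ne'
    exact ENNReal.mul_pos (by simp [exp_pos]) (hb_supp δ hδ).ne'
  refine ⟨isProbabilityMeasure_normalized_withDensity hpos hint, fun r hr => ?_⟩
  have hu : ∀ᵐ a ∂μ₀, a ∈ (scaleBall lam φ 1 b r)ᶜ →
      f a ≤ ENNReal.ofReal (exp (c - 3 / 8 * n * r ^ 2)) := by
    filter_upwards [hμs, hμK] with a h1 h2 haB
    obtain ⟨h3, -, w, hw, hfa⟩ := hc a h1 h2
    rw [hfa]
    have hx : r < (scaleNorm lam φ 1 (b - a)).toReal :=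
      (ENNReal.ofReal_lt_iff_lt_toReal (hδ.le.trans hr) h3).1 (not_le.1 haB)
    have h4 : r ^ 2 ≤ (scaleNorm lam φ 1 (b - a)).toReal ^ 2 := by
      have := hδ.le.trans hr
      gcongr
    have h5 := mul_le_mul_of_nonneg_left h4 hn
    refine ENNReal.ofReal_le_ofReal (exp_le_exp.2 ?_)
    linarith [large (hr.trans hx.le), le_abs_self w]
  have key := le_normalized_withDensity_apply (exp_pos (c - 5 / 8 * n * δ ^ 2)) (exp_pos _).le hB
    (measurableSet_scaleBall (lam := lam) (φ := φ) 1 b r) (hb_supp δ hδ) hint hv hu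
  -- Here `c` cancels.
  rw [← div_div, ← exp_sub] at key
  have he : c - 3 / 8 * n * r ^ 2 - (c - 5 / 8 * n * δ ^ 2) =
      -(3 / 8) * n * r ^ 2 + 5 / 8 * n * δ ^ 2 := by ring
  rwa [he] at key

variable [CompleteSpace H] [TopologicalSpace.SeparableSpace H]

theorem ae_scaleNorm_lt_top {Γ : H →L[ℝ] H} (hΓ : IsEigensystem Γ lam φ)
    {μ : Measure H} (hμ : IsCentredGaussian μ Γ) {σ : ℝ}
    (hσ : Summable fun k => lam k ^ (2 * σ)) :
    ∀ᵐ x ∂μ, scaleNorm lam φ (1 - σ) x < ∞ := by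
  have h := lintegral_scaleNorm_sq hΓ hμ (1 - σ)
  rw [sub_sub_cancel] at h
  have h2 := ae_lt_top ((measurable_scaleNorm (lam := lam) (φ := φ) (1 - σ)).pow_const 2)
    (h.trans_ne hσ.tsum_ofReal_ne_top)
  filter_upwards [h2] with x hx
  simpa using hx

theorem posteriorConcentrates_of_rate {Γ : H →L[ℝ] H} (hΓ : IsEigensystem Γ lam φ)
    {μξ : Measure H} (hμξ : IsCentredGaussian μξ Γ) {s σ K : ℝ} (hσ : 0 ≤ σ)
    (htr : Summable fun k => lam k ^ (2 * σ))
    (hs : 1 < s) (hσs : 1 + σ ≤ s) (hK : 0 ≤ K) {b : H} (hb : scaleNorm lam φ s b ≠ ∞)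
    {μ₀ : Measure H} [IsProbabilityMeasure μ₀] (hμs : ∀ᵐ a ∂μ₀, scaleNorm lam φ s a ≠ ∞)
    (hμK : ∀ᵐ a ∂μ₀, scaleNorm lam φ s (b - a) ≤ ENNReal.ofReal K)
    (hb_supp : b ∈ scaleSupport lam φ 1 μ₀) {z δ r : ℕ → ℝ} (hz : Tendsto z atTop atTop)
    (hδ : ∀ᶠ n in atTop, 0 < δ n) (hr : ∀ᶠ n in atTop, δ n ≤ r n)
    (hδA : ∀ᶠ n : ℕ in atTop, √n * z n * K ^ (σ / (s - 1)) * δ n ^ (1 - σ / (s - 1)) ≤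
      n / 8 * δ n ^ 2)
    (hlim : Tendsto (fun n : ℕ => exp (-(3 / 8) * n * r n ^ 2 + 5 / 8 * n * δ n ^ 2) /
      μ₀.real (scaleBall lam φ 1 b (δ n))) atTop (𝓝 0)) :
    PosteriorConcentrates μξ
      (fun n ξ => regressionPosterior lam φ μ₀ n (smallNoiseData b n ξ))
      (fun n => scaleBall lam φ 1 b (r n)) := by
  have := hμξ.isGaussian
  have : IsProbabilityMeasure μξ := inferInstance
  -- The lower bound `l n` is deterministic; randomness enters only through the event `‖ξ‖_{1-σ} ≤ z
  -- n`, whose probability tends to one because the norm is a.s. finite.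
  refine ⟨_, (sub_zero (1 : ℝ)) ▸ hlim.const_sub 1, ?_⟩
  have hmono : Monotone fun z : ℝ => {ξ | scaleNorm lam φ (1 - σ) ξ ≤ ENNReal.ofReal z} :=
    fun z₁ z₂ h ξ hξ => le_trans hξ (ENNReal.ofReal_le_ofReal h)
  have hun : μξ (⋃ z : ℝ, {ξ | scaleNorm lam φ (1 - σ) ξ ≤ ENNReal.ofReal z}) = 1 := by
    have h : ∀ᵐ ξ ∂μξ, ξ ∈ ⋃ z : ℝ, {ξ | scaleNorm lam φ (1 - σ) ξ ≤ ENNReal.ofReal z} := by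
      filter_upwards [ae_scaleNorm_lt_top hΓ hμξ htr] with ξ hξ
      exact mem_iUnion.2 ⟨_, (ENNReal.ofReal_toReal hξ.ne).ge⟩
    exact (measure_congr (eventuallyEq_univ.2 h)).trans measure_univ
  have hP := (tendsto_measure_iUnion_atTop (μ := μξ) hmono).comp hz
  rw [hun] at hP
  refine tendsto_of_tendsto_of_tendsto_of_le_of_le' hP tendsto_const_nhds ?_
    (Eventually.of_forall fun _ => prob_le_one)
  filter_upwards [hδ, hr, hδA, hz.eventually_ge_atTop 0] with n h1 h2 h3 h4
  refine measure_mono fun ξ hξ => ?_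
  exact (regressionPosterior_scaleBall_ge (fun k => (hΓ k).1) hσ hs hσs hK h4 hb hξ n hμs hμK
    hb_supp h1 h3).2 _ h2

end Regression

theorem PosteriorConcentrates.mono {Ω X : Type*} [MeasurableSpace Ω] [MeasurableSpace X]
    {P : Measure Ω} [IsProbabilityMeasure P] {post : ℕ → Ω → Measure X} {B B' : ℕ → Set X}
    (h : PosteriorConcentrates P post B) (hB : ∀ᶠ n in atTop, B n ⊆ B' n) :
    PosteriorConcentrates P post B' := by
  obtain ⟨l, hl, hP⟩ := h
  refine ⟨l, hl, tendsto_of_tendsto_of_tendsto_of_le_of_le' hP tendsto_const_nhds ?_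
    (Eventually.of_forall fun _ => prob_le_one)⟩
  filter_upwards [hB] with n hn
  exact measure_mono fun ξ hξ => le_trans hξ (measure_mono hn)

theorem eventually_const_mul_rpow_le {a b : ℝ} (hab : a < b) (C : ℝ) {D : ℝ} (hD : 0 < D) :
    ∀ᶠ n : ℕ in atTop, C * (n : ℝ) ^ a ≤ D * (n : ℝ) ^ b := by
  have h := ((tendsto_rpow_neg_atTop (sub_pos.2 hab)).comp
    tendsto_natCast_atTop_atTop).const_mul C
  rw [mul_zero] at h
  filter_upwards [h.eventually (ge_mem_nhds hD), eventually_gt_atTop 0] with n hn hn0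
  have hn0' : (0 : ℝ) < n := by exact_mod_cast hn0
  have h2 : (n : ℝ) ^ a = (n : ℝ) ^ (-(b - a)) * (n : ℝ) ^ b := by
    rw [← rpow_add hn0']
    ring_nf
  rw [h2, ← mul_assoc]
  exact mul_le_mul_of_nonneg_right hn (rpow_nonneg hn0'.le _)

/-! ### Choice of thresholds: well-posedness, consistency, rate -/

section Concentration

variable {H ι : Type*} [NormedAddCommGroup H] [InnerProductSpace ℝ H]
  {lam : ι → ℝ} {φ : HilbertBasis ι ℝ H}

theorem exists_scaleNorm_sub_le (hlam : ∀ k, 0 < lam k) {t : ℝ} {b : H}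
    (hb : scaleNorm lam φ t b ≠ ∞) (U : ℝ≥0) :
    ∃ K : ℝ, 0 < K ∧ ∀ a, scaleNorm lam φ t a ≤ U →
      scaleNorm lam φ t (b - a) ≤ ENNReal.ofReal K := by
  -- From `x ≤ 1 + x²` and the parallelogram bound; the summand `1` also makes the constant
  -- positive.
  set W : ℝ≥0∞ := 1 + 2 * (scaleNorm lam φ t b ^ 2 + (U : ℝ≥0∞) ^ 2) with hW
  have hWt : W ≠ ∞ := by
    refine ENNReal.add_ne_top.2 ⟨ENNReal.one_ne_top, ENNReal.mul_ne_top (by simp) ?_⟩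
    exact ENNReal.add_ne_top.2 ⟨ENNReal.pow_ne_top hb, ENNReal.pow_ne_top ENNReal.coe_ne_top⟩
  refine ⟨W.toReal, ENNReal.toReal_pos (by simp [hW]) hWt, fun a ha => ?_⟩
  rw [ENNReal.ofReal_toReal hWt]
  have h1 : scaleNorm lam φ t (b - a) ≤ 1 + scaleNorm lam φ t (b - a) ^ 2 := by
    rcases le_total (scaleNorm lam φ t (b - a)) 1 with h | h
    · exact h.trans le_self_add
    · exact (le_self_pow h two_ne_zero).trans le_add_self
  refine h1.trans (add_le_add_right ((scaleNorm_sub_sq_le hlam t b a).trans ?_) _)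
  gcongr

variable [MeasurableSpace H] [BorelSpace H] [Countable ι]

theorem posterior_well_defined (hlam : ∀ k, 0 < lam k) {s σ K : ℝ} (hσ : 0 ≤ σ)
    (hs : 1 < s) (hσs : 1 + σ ≤ s) (hK : 0 < K) {b ξ : H} (hb : scaleNorm lam φ s b ≠ ∞)
    (hξ : scaleNorm lam φ (1 - σ) ξ ≠ ∞)
    {μ₀ : Measure H} [IsProbabilityMeasure μ₀] (hμs : ∀ᵐ a ∂μ₀, scaleNorm lam φ s a ≠ ∞)
    (hμK : ∀ᵐ a ∂μ₀, scaleNorm lam φ s (b - a) ≤ ENNReal.ofReal K)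
    (hb_supp : b ∈ scaleSupport lam φ 1 μ₀) {n : ℕ} (hn : 0 < n) :
    (∀ᵐ a ∂μ₀, Summable (scaleInnerTerm lam φ 1 a (smallNoiseData b n ξ))) ∧
      IsProbabilityMeasure (regressionPosterior lam φ μ₀ n (smallNoiseData b n ξ)) := by
  have hz := (ENNReal.ofReal_toReal hξ).ge
  have hz0 : 0 ≤ (scaleNorm lam φ (1 - σ) ξ).toReal := ENNReal.toReal_nonneg
  constructor
  · obtain ⟨c, hc⟩ := exists_posteriorDensity_eq (φ := φ) hlam hσ hs hσs hK.le hz0 hb hz n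
    filter_upwards [hμs, hμK] with a h1 h2
    exact (hc a h1 h2).2.1
  · have hn0 : (0 : ℝ) < n := by exact_mod_cast hn
    set A := √n * (scaleNorm lam φ (1 - σ) ξ).toReal * K ^ (σ / (s - 1)) with hA
    have hA0 : 0 ≤ A := by positivity
    -- With `n` and `ξ` fixed the threshold may be large: for `δ ≥ 1` one has `δ^(1-θ) ≤ δ`, so `A ≤
    -- (n/8) δ` suffices.
    have hδ1 : 1 ≤ max 1 (8 * A / n) := le_max_left _ _
    refine (regressionPosterior_scaleBall_ge hlam hσ hs hσs hK.le hz0 hb hz n hμs hμK hb_supp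
      (zero_lt_one.trans_le hδ1) ?_).1
    rw [← hA]
    have hδA : A ≤ n / 8 * max 1 (8 * A / n) := by
      refine le_trans (le_of_eq ?_) (mul_le_mul_of_nonneg_left (le_max_right _ _) (by positivity))
      field_simp
    have hp1 : 1 - σ / (s - 1) ≤ 1 := by
      have := div_nonneg hσ (sub_pos.2 hs).le
      linarith
    set δ := max 1 (8 * A / n) with hδ
    calc A * δ ^ (1 - σ / (s - 1)) ≤ A * δ ^ (1 : ℝ) :=
          mul_le_mul_of_nonneg_left (rpow_le_rpow_of_exponent_le hδ1 hp1) hA0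
      _ ≤ (n / 8 * δ) * δ := by rw [rpow_one]; gcongr
      _ = n / 8 * δ ^ 2 := by ring

variable [CompleteSpace H] [TopologicalSpace.SeparableSpace H]

theorem posterior_consistent {Γ : H →L[ℝ] H} (hΓ : IsEigensystem Γ lam φ)
    {μξ : Measure H} (hμξ : IsCentredGaussian μξ Γ) {s σ K : ℝ} (hσ : 0 ≤ σ)
    (htr : Summable fun k => lam k ^ (2 * σ))
    (hs : 1 < s) (hσs : 1 + σ ≤ s) (hK : 0 < K) {b : H} (hb : scaleNorm lam φ s b ≠ ∞)
    {μ₀ : Measure H} [IsProbabilityMeasure μ₀] (hμs : ∀ᵐ a ∂μ₀, scaleNorm lam φ s a ≠ ∞)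
    (hμK : ∀ᵐ a ∂μ₀, scaleNorm lam φ s (b - a) ≤ ENNReal.ofReal K)
    (hb_supp : b ∈ scaleSupport lam φ 1 μ₀) :
    PosteriorConsistent μξ (fun n ξ => regressionPosterior lam φ μ₀ n (smallNoiseData b n ξ))
      (scaleBall lam φ 1 b) := by
  intro ε hε
  refine posteriorConcentrates_of_rate hΓ hμξ hσ htr hs hσs hK.le hb hμs hμK hb_supp
    -- Any `z n → ∞` with `√n * z n = o(n)` would do. With `δ = ε/2` and `r = ε` the exponent is
    -- `-(7/32) n ε²`.
    (z := fun n => (n : ℝ) ^ (1 / 4 : ℝ)) (δ := fun _ => ε / 2)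
    ((tendsto_rpow_atTop (by norm_num)).comp tendsto_natCast_atTop_atTop)
    (Eventually.of_forall fun _ => by positivity) (Eventually.of_forall fun _ => by linarith) ?_ ?_
  · filter_upwards [eventually_const_mul_rpow_le (show (3 / 4 : ℝ) < 1 by norm_num)
      (K ^ (σ / (s - 1)) * (ε / 2) ^ (1 - σ / (s - 1)))
      (show 0 < 1 / 8 * (ε / 2) ^ 2 by positivity), eventually_gt_atTop 0] with n hn hn0
    have hn0' : (0 : ℝ) < n := by exact_mod_cast hn0
    have h3 : √(n : ℝ) * (n : ℝ) ^ (1 / 4 : ℝ) = (n : ℝ) ^ (3 / 4 : ℝ) := by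
      rw [sqrt_eq_rpow, ← rpow_add hn0']
      norm_num
    rw [rpow_one] at hn
    rw [h3]
    linarith
  · have h1 : Tendsto (fun n : ℕ => (7 / 32 * ε ^ 2) * (n : ℝ)) atTop atTop :=
      tendsto_natCast_atTop_atTop.const_mul_atTop (by positivity)
    have h2 := (tendsto_exp_neg_atTop_nhds_zero.comp h1).div_const
      (μ₀.real (scaleBall lam φ 1 b (ε / 2)))
    rw [zero_div] at h2
    refine h2.congr fun n => ?_
    simp only [Function.comp]
    congr 2
    ring

theorem posterior_consistent_with_rate {Γ : H →L[ℝ] H} (hΓ : IsEigensystem Γ lam φ)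
    {μξ : Measure H} (hμξ : IsCentredGaussian μξ Γ) {s σ K : ℝ} (hσ : 0 ≤ σ)
    (htr : Summable fun k => lam k ^ (2 * σ))
    (hs : 1 < s) (hσs : 1 + σ ≤ s) (hK : 0 < K) {b : H} (hb : scaleNorm lam φ s b ≠ ∞)
    {μ₀ : Measure H} [IsProbabilityMeasure μ₀] (hμs : ∀ᵐ a ∂μ₀, scaleNorm lam φ s a ≠ ∞)
    (hμK : ∀ᵐ a ∂μ₀, scaleNorm lam φ s (b - a) ≤ ENNReal.ofReal K)
    (hb_supp : b ∈ scaleSupport lam φ 1 μ₀) {ρ C κ : ℝ} (hρ : 0 < ρ) (hC : 0 < C)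
    (hball : ∀ᶠ ε : ℝ in 𝓝[>] 0, -C * ε ^ (-ρ) ≤ Real.log (μ₀.real (scaleBall lam φ 1 b ε)))
    (hκ : 0 < κ) (hκσ : 2 * κ * (1 + σ / (s - 1)) < 1) (hκρ : κ * (2 + ρ) ≤ 1) :
    PosteriorConsistentWithRate μξ
      (fun n ξ => regressionPosterior lam φ μ₀ n (smallNoiseData b n ξ))
      (scaleBall lam φ 1 b) (fun n => (n : ℝ) ^ (-κ)) := by
  have h2κ : 0 < 1 - 2 * κ := by nlinarith [mul_pos hκ hρ]
  set θ := σ / (s - 1) with hθ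
  -- The noise condition at `δ = n^(-κ)` needs `γ < (1 - 2κ(1+θ)) / 2`; this is half of that room.
  set γ := (1 - 2 * κ * (1 + θ)) / 4 with hγ
  have hγ0 : 0 < γ := by rw [hγ]; linarith
  have hδ0 : ∀ᶠ n : ℕ in atTop, 0 < (n : ℝ) ^ (-κ) := by
    filter_upwards [eventually_gt_atTop 0] with n hn
    exact rpow_pos_of_pos (by exact_mod_cast hn) _
  -- `M = 5 + 3C` gives `-(3/8) M² + 5/8 ≤ -1 - C`: the `C` absorbs the small ball cost and the `1`
  -- leaves `exp(-n^(1-2κ))`.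
  have hM1 : 1 ≤ 5 + 3 * C := by linarith
  refine ⟨5 + 3 * C, by linarith, posteriorConcentrates_of_rate hΓ hμξ hσ htr hs hσs hK.le hb
    hμs hμK hb_supp (z := fun n => (n : ℝ) ^ γ) (δ := fun n => (n : ℝ) ^ (-κ))
    ((tendsto_rpow_atTop hγ0).comp tendsto_natCast_atTop_atTop) hδ0 ?_ ?_ ?_⟩
  · filter_upwards [hδ0] with n hn
    nlinarith
  · have hexp : 1 / 2 + γ + -κ * (1 - θ) < 1 + (-κ + -κ) := by rw [hγ]; linarith
    filter_upwards [eventually_const_mul_rpow_le hexp (K ^ θ) (show (0 : ℝ) < 1 / 8 by norm_num),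
      eventually_gt_atTop 0] with n hn hn0
    have hn0' : (0 : ℝ) < n := by exact_mod_cast hn0
    rw [rpow_add hn0', rpow_add hn0', rpow_add hn0', rpow_add hn0', rpow_one,
      rpow_mul hn0'.le, ← sqrt_eq_rpow] at hn
    linarith
  · have h1 : Tendsto (fun n : ℕ => exp (-(n : ℝ) ^ (1 - 2 * κ))) atTop (𝓝 0) :=
      tendsto_exp_neg_atTop_nhds_zero.comp
        ((tendsto_rpow_atTop h2κ).comp tendsto_natCast_atTop_atTop)
    have hδlim : Tendsto (fun n : ℕ => (n : ℝ) ^ (-κ)) atTop (𝓝[>] 0) :=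
      tendsto_nhdsWithin_iff.2
        ⟨(tendsto_rpow_neg_atTop hκ).comp tendsto_natCast_atTop_atTop, hδ0⟩
    refine squeeze_zero' (Eventually.of_forall fun n => by positivity) ?_ h1
    filter_upwards [hδlim.eventually hball, hδ0, eventually_ge_atTop 1] with n hn hδ hn1
    have hn1' : (1 : ℝ) ≤ n := by exact_mod_cast hn1
    have hn0' : (0 : ℝ) < n := by linarith
    have hm : 0 < μ₀.real (scaleBall lam φ 1 b ((n : ℝ) ^ (-κ))) :=
      ENNReal.toReal_pos (hb_supp _ hδ).ne' (measure_ne_top _ _)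
    rw [div_le_iff₀ hm]
    rw [← exp_log hm, ← exp_add, exp_le_exp]
    have e1 : (n : ℝ) * ((n : ℝ) ^ (-κ)) ^ 2 = (n : ℝ) ^ (1 - 2 * κ) := by
      rw [← rpow_natCast, ← rpow_mul hn0'.le, ← rpow_one_add' hn0'.le]
      · push_cast; ring_nf
      · push_cast; linarith
    -- This is `κρ ≤ 1 - 2κ`: the small ball exponent does not exceed the order of `n δ²`.
    have e2 : ((n : ℝ) ^ (-κ)) ^ (-ρ) ≤ (n : ℝ) ^ (1 - 2 * κ) := by
      rw [← rpow_mul hn0'.le]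
      exact rpow_le_rpow_of_exponent_le hn1' (by linarith)
    have e3 := mul_le_mul_of_nonneg_left e2 hC.le
    have e4 : 0 < (n : ℝ) ^ (1 - 2 * κ) := rpow_pos_of_pos hn0' _
    have e5 : -(3 / 8) * (n : ℝ) * ((5 + 3 * C) * (n : ℝ) ^ (-κ)) ^ 2
        + 5 / 8 * n * ((n : ℝ) ^ (-κ)) ^ 2 =
        (-(3 / 8) * (5 + 3 * C) ^ 2 + 5 / 8) * (n : ℝ) ^ (1 - 2 * κ) := by
      rw [← e1]; ring
    rw [e5]
    have e6 : -(3 / 8) * (5 + 3 * C) ^ 2 + 5 / 8 ≤ -1 - C := by nlinarith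
    have e7 := mul_le_mul_of_nonneg_right e6 e4.le
    linarith

end Concentration

/-! ### The main theorem -/

theorem mainTheorem3
    {H : Type*} [NormedAddCommGroup H] [InnerProductSpace ℝ H] [CompleteSpace H]
    [TopologicalSpace.SeparableSpace H] [MeasurableSpace H] [BorelSpace H]
    {ι : Type*} (Γ : H →L[ℝ] H) (lam : ι → ℝ) (φ : HilbertBasis ι ℝ H)
    (hΓ : IsEigensystem Γ lam φ)
    (μξ : Measure H) (hμξ : IsCentredGaussian μξ Γ)
    (σ₀ : ℝ) (hσ₀ : 0 ≤ σ₀)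
    (htrace : ∀ σ : ℝ, σ₀ < σ → Summable fun k => lam k ^ (2 * σ))
    (μ₀ : Measure H) [IsProbabilityMeasure μ₀]
    (s : ℝ) (hs : 1 + σ₀ < s)
    (U : ℝ≥0) (hU : ∀ᵐ a ∂μ₀, scaleNorm lam φ s a ≤ U)
    (aT : H) (haT_supp : aT ∈ scaleSupport lam φ 1 μ₀) (haT_reg : aT ∈ scaleSpace lam φ s) :
    -- the posteriors are well defined
    (∀ n : ℕ, 0 < n → ∀ᵐ ξ ∂μξ,
      (∀ᵐ a ∂μ₀, Summable (scaleInnerTerm lam φ 1 a (smallNoiseData aT n ξ))) ∧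
      IsProbabilityMeasure (regressionPosterior lam φ μ₀ n (smallNoiseData aT n ξ))) ∧
    -- consistency in the Cameron–Martin norm
    PosteriorConsistent μξ (fun n ξ => regressionPosterior lam φ μ₀ n (smallNoiseData aT n ξ))
      (scaleBall lam φ 1 aT) ∧
    -- rate under a small ball bound
    (∀ ρ : ℝ, 0 < ρ →
      (∃ C : ℝ, 0 < C ∧ ∀ᶠ ε : ℝ in 𝓝[>] 0,
        -C * ε ^ (-ρ) ≤ Real.log (μ₀.real (scaleBall lam φ 1 aT ε))) →
      ∀ κ : ℝ, κ < min (1 / (2 * (2 - (s - 1 - σ₀) / (s - 1)))) (1 / (2 + ρ)) →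
        PosteriorConsistentWithRate μξ
          (fun n ξ => regressionPosterior lam φ μ₀ n (smallNoiseData aT n ξ))
          (scaleBall lam φ 1 aT) (fun n => (n : ℝ) ^ (-κ))) := by

  have hlam : ∀ k, 0 < lam k := fun k => (hΓ k).1
  -- A summable family of positive terms has a countable index set.
  have hcount : Countable ι := by
    have h := (htrace (σ₀ + 1) (by linarith)).countable_support
    have hsupp : (Function.support fun k => lam k ^ (2 * (σ₀ + 1))) = univ :=
      eq_univ_of_forall fun k => (rpow_pos_of_pos (hlam k) _).ne'
    rw [hsupp] at h
    exact countable_univ_iff.1 h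
  have hs1 : 1 < s := by linarith
  have hs0 : 0 < s - 1 := by linarith
  have hb : scaleNorm lam φ s aT ≠ ∞ := (show scaleNorm lam φ s aT < ∞ from haT_reg).ne
  obtain ⟨K, hK, hKa⟩ := exists_scaleNorm_sub_le (φ := φ) hlam hb U
  have hμs : ∀ᵐ a ∂μ₀, scaleNorm lam φ s a ≠ ∞ := by
    filter_upwards [hU] with a ha using ne_top_of_le_ne_top ENNReal.coe_ne_top ha
  have hμK : ∀ᵐ a ∂μ₀, scaleNorm lam φ s (aT - a) ≤ ENNReal.ofReal K := by
    filter_upwards [hU] with a ha using hKa a ha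
  obtain ⟨σ, hσ, hσs⟩ := exists_between (show σ₀ < s - 1 by linarith)
  refine ⟨fun n hn => ?_, ?_, ?_⟩
  · filter_upwards [ae_scaleNorm_lt_top hΓ hμξ (htrace σ hσ)] with ξ hξ
    exact posterior_well_defined hlam (by linarith) hs1 (by linarith) hK hb hξ.ne hμs hμK haT_supp
      hn
  · exact posterior_consistent hΓ hμξ (by linarith) (htrace σ hσ) hs1 (by linarith) hK hb hμs hμK
      haT_supp
  · rintro ρ hρ ⟨C, hC, hball⟩ κ hκ
    have he : 2 - (s - 1 - σ₀) / (s - 1) = 1 + σ₀ / (s - 1) := by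
      field_simp
      ring
    rw [he] at hκ
    have hθ₀ : 0 ≤ σ₀ / (s - 1) := div_nonneg hσ₀ hs0.le
    have hmin : 0 < min (1 / (2 * (1 + σ₀ / (s - 1)))) (1 / (2 + ρ)) := by positivity
    -- Since `κ` may be nonpositive, a faster positive rate `κ'` is proved instead. The strict bound
    -- on `κ'` leaves room for some `τ > σ₀` with `2κ'(1 + τ/(s-1)) < 1`, as summability is known
    -- only above `σ₀`.
    obtain ⟨κ', hκ', hκ'min⟩ := exists_between (max_lt hmin hκ)
    obtain ⟨hκ'0, hκκ'⟩ := max_lt_iff.1 hκ'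
    obtain ⟨hm1, hm2⟩ := lt_min_iff.1 hκ'min
    rw [lt_div_iff₀ (by positivity)] at hm1 hm2
    have hlt : σ₀ < (1 / (2 * κ') - 1) * (s - 1) := by
      rw [← div_lt_iff₀ hs0, lt_sub_iff_add_lt, lt_div_iff₀ (by positivity)]
      linarith
    obtain ⟨τ, hτ, hτlt⟩ := exists_between (lt_min (show σ₀ < s - 1 by linarith) hlt)
    obtain ⟨hτs, hτκ⟩ := lt_min_iff.1 hτlt
    rw [← div_lt_iff₀ hs0, lt_sub_iff_add_lt, lt_div_iff₀ (by positivity)] at hτκ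
    obtain ⟨M, hM, hconc⟩ := posterior_consistent_with_rate hΓ hμξ (by linarith) (htrace τ hτ) hs1
      (by linarith) hK hb hμs hμK haT_supp hρ hC hball hκ'0 (by linarith) hm2.le
    have := hμξ.isGaussian
    refine ⟨M, hM, hconc.mono ?_⟩
    filter_upwards [eventually_ge_atTop 1] with n hn
    refine scaleBall_mono _ _ (mul_le_mul_of_nonneg_left ?_ hM.le)
    exact rpow_le_rpow_of_exponent_le (by exact_mod_cast hn) (by linarith)
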